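/- Let $d\ge 1$ be an integer, let $\alpha\in(0,2)$, and write $B_r=\{x\in\mathbb{R}^d: |x|<r\}$. For a function $u:\mathbb{R}^d\to\mathbb{R}$ and $x\in\mathbb{R}^d$ put $$\Delta^{\alpha/2}u(x)=C_{\alpha,d}\,\lim_{\varepsilon\to0+}\int_{|y-x|>\varepsilon}\frac{u(y)-u(x)}{|y-x|^{d+\alpha}}\,dy,\qquad C_{\alpha,d}=\frac{\Gamma((d+\alpha)/2)}{2^{-\alpha}\pi^{d/2}\,|\Gamma(-\alpha/2)|},$$ where an equation $\Delta^{\alpha/2}u(x)=0$ includes the assertion that the integrals converge absolutely and that the limit exists. Then there exists a bounded continuous function $u:\mathbb{R}^d\to\mathbb{R}$ which is infinitely often differentiable in $B_1$ and satisfies $$\Delta^{\alpha/2}u(x)=0\quad(x\in B_1),\qquad u(x)>0\quad(x\in B_1\setminus\{0\}),\qquad u(0)=0.$$ Moreover, the classical local Harnack inequality and the local maximum principle fail for $\Delta^{\alpha/2}$, that is, none of the following three statements is true: 1. (Local Harnack inequality) There is a constant $c\ge1$ such that every continuous $u:\mathbb{R}^d\to\mathbb{R}$ with $\Delta^{\alpha/2}u=0$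 in $B_1$ and $u\ge0$ in $B_1$ satisfies $u(x)\le c\,u(y)$ for all $x,y\in B_{1/2}$. 2. (Local weak maximum principle) Every continuous $u:\mathbb{R}^d\to\mathbb{R}$ with $\Delta^{\alpha/2}u=0$ in $B_1$ satisfies $u(x)\le\max_{\partial B_1}u$ for all $x\in B_1$. 3. (Local strong maximum principle) Every continuous $u:\mathbb{R}^d\to\mathbb{R}$ with $\Delta^{\alpha/2}u=0$ in $B_1$ which attains its maximum over $B_1$ at a point of $B_1$ is constant in $B_1$. -/

import Mathlib

open MeasureTheory Filter Topology Metric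
open scoped ContDiff

noncomputable section

/-- The normalizing constant
`C_{α,d} = Γ((d+α)/2) / (2^{-α} π^{d/2} |Γ(-α/2)|)` of the fractional Laplacian on `ℝ^d`. -/
def fracLaplacianConst (d : ℕ) (α : ℝ) : ℝ :=
  Real.Gamma ((d + α) / 2) /
    ((2 : ℝ) ^ (-α) * Real.pi ^ ((d : ℝ) / 2) * |Real.Gamma (-α / 2)|)

/-- The singular integrand `y ↦ (u(y) - u(x)) / |y - x|^{d+α}`. -/
def fracLaplacianIntegrand {d : ℕ} (α : ℝ) (u : EuclideanSpace ℝ (Fin d) → ℝ)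
    (x y : EuclideanSpace ℝ (Fin d)) : ℝ :=
  (u y - u x) / ‖y - x‖ ^ ((d : ℝ) + α)

/-- `Δ^{α/2} u (x)` exists and equals `L`: the truncated integrals over `{|y - x| > ε}` all
converge absolutely, and
`C_{α,d} ∫_{|y-x|>ε} (u(y) - u(x)) / |y - x|^{d+α} dy` tends to `L` as `ε → 0+`. -/
def HasFracLaplacianAt {d : ℕ} (α : ℝ) (u : EuclideanSpace ℝ (Fin d) → ℝ) (L : ℝ)
    (x : EuclideanSpace ℝ (Fin d)) : Prop :=
  (∀ ε : ℝ, 0 < ε →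
    IntegrableOn (fracLaplacianIntegrand α u x) {y | ε < ‖y - x‖} volume) ∧
  Tendsto
    (fun ε : ℝ => fracLaplacianConst d α *
      ∫ y in {y | ε < ‖y - x‖}, fracLaplacianIntegrand α u x y)
    (𝓝[>] 0) (𝓝 L)

/-- `u` is `α`-harmonic in `D`: `Δ^{α/2} u (x) = 0` for every `x ∈ D`. -/
def IsAlphaHarmonicOn {d : ℕ} (α : ℝ) (u : EuclideanSpace ℝ (Fin d) → ℝ)
    (D : Set (EuclideanSpace ℝ (Fin d))) : Prop :=
  ∀ x ∈ D, HasFracLaplacianAt α u 0 x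

/-- The classical local Harnack inequality for `Δ^{α/2}` on `ℝ^d`; nonnegativity of `u` is
required only inside the unit ball. -/
def LocalHarnackInequality (d : ℕ) (α : ℝ) : Prop :=
  ∃ c : ℝ, 1 ≤ c ∧ ∀ u : EuclideanSpace ℝ (Fin d) → ℝ,
    Continuous u → IsAlphaHarmonicOn α u (ball 0 1) → (∀ x ∈ ball 0 1, 0 ≤ u x) →
      ∀ x ∈ ball 0 (1 / 2), ∀ y ∈ ball 0 (1 / 2), u x ≤ c * u y

/-- The local maximum principle in its weak form: a continuous function that is `α`-harmonic in
the unit ball is bounded there from above by its supremum over the unit sphere. -/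
def LocalWeakMaximumPrinciple (d : ℕ) (α : ℝ) : Prop :=
  ∀ u : EuclideanSpace ℝ (Fin d) → ℝ,
    Continuous u → IsAlphaHarmonicOn α u (ball 0 1) →
      ∀ M : ℝ, (∀ y ∈ sphere 0 1, u y ≤ M) → ∀ x ∈ ball 0 1, u x ≤ M

/-- The local maximum principle in its strong form: a continuous function that is `α`-harmonic in
the unit ball and attains its maximum over the ball inside the ball is constant there. -/
def LocalStrongMaximumPrinciple (d : ℕ) (α : ℝ) : Prop :=
  ∀ u : EuclideanSpace ℝ (Fin d) → ℝ,
    Continuous u → IsAlphaHarmonicOn α u (ball 0 1) →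
      ∀ x₀ ∈ ball 0 1, (∀ x ∈ ball 0 1, u x ≤ u x₀) → ∀ x ∈ ball 0 1, u x = u x₀

end

/-!
The counterexample is explicit. With `p = α / 2` and `x₊ = max x 0`, put
`D_{A,B}(y) = (B - |y|²)₊ ^ p - (A - |y|²)₊ ^ p` for `1 ≤ A ≤ B` (`powDiff`). Each `D_{A,B}` is
`α`-harmonic in the unit ball, and
`u = D_{1,2} / D_{1,2}(0) - D_{2,3} / D_{2,3}(0)`
vanishes at the origin and is positive on the rest of the closed unit ball.

*Harmonicity.* In polar coordinates around `x`, after the symmetrization `h ↦ -h`, the truncated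
singular integral of `D_{A,B}` is an average over directions `θ` of one-dimensional integrals of
second differences (`hasFracLaplacianAt_zero_of_second_difference`). Along the ray `x + r θ` one has
`s - |x + r θ|² = δ - 2 a r - r²` with `δ = s - |x|²` and `a = ⟪x, θ⟫`. Since
`D_{A,B} = p ∫_A^B (s - |·|²)₊ ^ (p - 1) ds`, Fubini's theorem
(`exists_bound_second_difference`) leaves the integrals
`∫_ε^∞ (δ - 2 a r - r²)₊ ^ (p - 1) r ^ (-1 - 2 p) dr`. The substitution `r = 1 / (η + a / δ)` turns
them into `∫ (η + a / δ) (δ η² - c)₊ ^ (p - 1) dη` with `c = 1 + a² / δ`. The part with the factor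
`η` has an explicit primitive. The remaining parts for the rays `θ` and `-θ` cancel, up to an
integral over a short interval near `1 / ε`. The sum over both rays is therefore
`δ ^ (p - 1) ε ^ (-2 p) / p + O(ε ^ (2 - 2 p))` (`exists_bound_ray_integrals`). The first term is
exactly what the subtraction of the value at `x` removes, and the error tends to zero because
`2 - 2 p > 0`.

*Positivity.* For `t = |x|²` the function `s ↦ (s - t) ^ p - (1 - t / 2) ^ (p - 1) s ^ p` increases
on `[1, 2]` and decreases on `[2, 3]`; comparing its values at `1, 2, 3` gives
`normalized_rpow_difference_lt`.

The three principles fail for `u` and `-u`: `u` is nonnegative in the ball with a zero at the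
origin, while `-u` has its maximum over the ball at the origin, is not constant, and is a negative
constant on the unit sphere because `u` is radial.
-/

/-! ### The truncated power -/

/-- The truncated power `x₊ ^ p`.  For `p ≠ 0` it vanishes on `(-∞, 0]`, also for negative `p`,
because `0 ^ p = 0` in Mathlib. -/
noncomputable def posPow (p x : ℝ) : ℝ := max x 0 ^ p

lemma posPow_nonneg (p x : ℝ) : 0 ≤ posPow p x := Real.rpow_nonneg (le_max_right _ _) _

lemma posPow_of_nonneg {p x : ℝ} (hx : 0 ≤ x) : posPow p x = x ^ p := by
  rw [posPow, max_eq_left hx]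

lemma posPow_of_nonpos {p x : ℝ} (hp : p ≠ 0) (hx : x ≤ 0) : posPow p x = 0 := by
  rw [posPow, max_eq_right hx, Real.zero_rpow hp]

lemma measurable_posPow (p : ℝ) : Measurable (posPow p) := by
  unfold posPow
  exact (measurable_id.max measurable_const).pow_const p

lemma continuous_posPow {p : ℝ} (hp : 0 ≤ p) : Continuous (posPow p) := by
  unfold posPow
  exact (continuous_id.max continuous_const).rpow_const fun _ => Or.inr hp

lemma monotone_posPow {p : ℝ} (hp : 0 ≤ p) : Monotone (posPow p) := fun _ _ h =>
  Real.rpow_le_rpow (le_max_right _ _) (max_le_max_right 0 h) hp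

/-- Homogeneity of the truncated power. -/
lemma posPow_mul {p t : ℝ} (ht : 0 ≤ t) (x : ℝ) : posPow p (t * x) = t ^ p * posPow p x := by
  rw [posPow, posPow, ← Real.mul_rpow ht (le_max_right _ _), mul_max_of_nonneg _ _ ht, mul_zero]

lemma hasDerivAt_posPow {p x : ℝ} (hp₀ : p ≠ 0) (hp₁ : p ≠ 1) (hx : x ≠ 0) :
    HasDerivAt (posPow p) (p * posPow (p - 1) x) x := by
  rcases lt_or_gt_of_ne hx with h | h
  · rw [posPow_of_nonpos (sub_ne_zero.2 hp₁) h.le, mul_zero]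
    refine (hasDerivAt_const x (0 : ℝ)).congr_of_eventuallyEq ?_
    filter_upwards [gt_mem_nhds h] with y hy
    exact posPow_of_nonpos hp₀ hy.le
  · rw [posPow_of_nonneg h.le]
    refine (Real.hasDerivAt_rpow_const (p := p) (Or.inl hx)).congr_of_eventuallyEq ?_
    filter_upwards [lt_mem_nhds h] with y hy
    exact posPow_of_nonneg hy.le

/-- The fundamental theorem of calculus for a continuous monotone function that is differentiable
off a countable set; integrability of the derivative is automatic. -/
lemma intervalIntegrable_and_integral_eq_of_monotoneOn {f f' : ℝ → ℝ} {a b : ℝ} {s : Set ℝ}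
    (hs : s.Countable) (hc : ContinuousOn f (Set.uIcc a b)) (hm : MonotoneOn f (Set.uIcc a b))
    (hd : ∀ x ∈ Set.uIcc a b, x ∉ s → HasDerivAt f (f' x) x) :
    IntervalIntegrable f' volume a b ∧ ∫ x in a..b, f' x = f b - f a := by
  have hi : IntervalIntegrable f' volume a b := by
    refine hm.intervalIntegrable_deriv.congr_ae ?_
    have h0 : ∀ᵐ x ∂(volume : Measure ℝ), x ∉ s :=
      measure_eq_zero_iff_ae_notMem.1 (hs.measure_zero _)
    rw [EventuallyEq, ae_restrict_iff' measurableSet_uIoc]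
    filter_upwards [h0] with x hx hxI
    exact (hd x (Set.uIoc_subset_uIcc hxI) hx).deriv
  refine ⟨hi, integral_eq_of_hasDerivAt_off_countable f f' hs hc (fun x hx => ?_) hi⟩
  exact hd x (Set.Ioo_subset_Icc_self hx.1) hx.2

/-- The singularity of `posPow (p - 1)` at `0` is integrable, with primitive `posPow p / p`. -/
lemma integral_posPow_sub_one {p : ℝ} (hp₀ : 0 < p) (hp₁ : p < 1) (k a b : ℝ) :
    IntervalIntegrable (fun s => posPow (p - 1) (s - k)) volume a b ∧
      ∫ s in a..b, posPow (p - 1) (s - k) = (posPow p (b - k) - posPow p (a - k)) / p := by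
  have h := intervalIntegrable_and_integral_eq_of_monotoneOn (a := a) (b := b)
    (f := fun s => posPow p (s - k) / p) (f' := fun s => posPow (p - 1) (s - k))
    (Set.countable_singleton k)
    (((continuous_posPow hp₀.le).comp (continuous_id.sub continuous_const)).div_const p).continuousOn
    (fun x _ y _ hxy => div_le_div_of_nonneg_right
      (monotone_posPow hp₀.le (sub_le_sub_right hxy k)) hp₀.le)
    (fun x _ hx => by
      have := ((hasDerivAt_posPow hp₀.ne' hp₁.ne (sub_ne_zero.2 hx)).comp x
        ((hasDerivAt_id x).sub_const k)).div_const p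
      refine this.congr_deriv ?_
      field_simp)
  refine ⟨h.1, h.2.trans ?_⟩
  ring

lemma integral_mul_posPow_quadratic {p δ c : ℝ} (hp₀ : 0 < p) (hp₁ : p < 1)
    (hδ : 0 < δ) (hc : 0 < c) {x y : ℝ} (hx : 0 ≤ x) (hy : 0 ≤ y) :
    IntervalIntegrable (fun η => η * posPow (p - 1) (δ * η ^ 2 - c)) volume x y ∧
      ∫ η in x..y, η * posPow (p - 1) (δ * η ^ 2 - c) =
        (posPow p (δ * y ^ 2 - c) - posPow p (δ * x ^ 2 - c)) / (2 * δ * p) := by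
  have hnn : ∀ z ∈ Set.uIcc x y, 0 ≤ z := fun z hz => (le_min hx hy).trans hz.1
  have hcont : Continuous fun η : ℝ => posPow p (δ * η ^ 2 - c) / (2 * δ * p) :=
    ((continuous_posPow hp₀.le).comp
      (by fun_prop : Continuous fun η : ℝ => δ * η ^ 2 - c)).div_const _
  have hmono : MonotoneOn (fun η : ℝ => posPow p (δ * η ^ 2 - c) / (2 * δ * p)) (Set.uIcc x y) := by
    intro z hz w _ hzw
    have := hnn z hz
    refine div_le_div_of_nonneg_right (monotone_posPow hp₀.le ?_) (by positivity)
    gcongr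
  have hderiv : ∀ z ∈ Set.uIcc x y, z ∉ ({√(c / δ)} : Set ℝ) →
      HasDerivAt (fun η : ℝ => posPow p (δ * η ^ 2 - c) / (2 * δ * p))
        (z * posPow (p - 1) (δ * z ^ 2 - c)) z := by
    intro z hz hzs
    have hne : δ * z ^ 2 - c ≠ 0 := fun h0 => hzs <| by
      rw [Set.mem_singleton_iff, eq_comm, Real.sqrt_eq_iff_mul_self_eq (by positivity) (hnn z hz)]
      field_simp
      linarith
    have hin : HasDerivAt (fun η : ℝ => δ * η ^ 2 - c) (δ * (2 * z)) z := by
      simpa using (((hasDerivAt_id z).pow 2).const_mul δ).sub_const c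
    have h := ((hasDerivAt_posPow hp₀.ne' hp₁.ne hne).comp z hin).div_const (2 * δ * p)
    refine h.congr_deriv ?_
    generalize posPow (p - 1) (δ * z ^ 2 - c) = q
    field_simp
  have h := intervalIntegrable_and_integral_eq_of_monotoneOn (Set.countable_singleton _)
    hcont.continuousOn hmono hderiv
  refine ⟨h.1, h.2.trans ?_⟩
  ring

lemma intervalIntegrable_posPow_quadratic {p δ c : ℝ} (hp₀ : 0 < p) (hp₁ : p < 1) (hδ : 0 < δ)
    (hc : 0 < c) {x y : ℝ} (hx : 0 ≤ x) (hy : 0 ≤ y) :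
    IntervalIntegrable (fun η => posPow (p - 1) (δ * η ^ 2 - c)) volume x y := by
  have hi := (integral_mul_posPow_quadratic hp₀ hp₁ hδ hc hx hy).1
  refine (hi.const_mul (√(c / δ))⁻¹).mono_fun'
    ((measurable_posPow _).comp (by fun_prop)).aestronglyMeasurable ?_
  rw [Filter.EventuallyLE, ae_restrict_iff' measurableSet_uIoc]
  refine Filter.Eventually.of_forall fun z hz => ?_
  have hz0 : 0 ≤ z := (le_min hx hy).trans (Set.uIoc_subset_uIcc hz).1
  have hs : 0 < √(c / δ) := Real.sqrt_pos.2 (by positivity)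
  rw [Real.norm_of_nonneg (posPow_nonneg _ _)]
  -- below the zero `√(c / δ)` of the quadratic both sides vanish, above it `η / √(c / δ) ≥ 1`
  rcases le_total z (√(c / δ)) with h | h
  · have h1 : z ^ 2 ≤ c / δ := by
      have := pow_le_pow_left₀ hz0 h 2
      rwa [Real.sq_sqrt (by positivity)] at this
    rw [le_div_iff₀ hδ] at h1
    rw [posPow_of_nonpos (by linarith) (by linarith)]
    simp
  · rw [← mul_assoc]
    refine le_mul_of_one_le_left (posPow_nonneg _ _) ?_
    rw [inv_mul_eq_div, one_le_div hs]
    exact h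

/-! ### The one-dimensional identity -/

/-- The substitution `r = 1 / (η + a / δ)`, which turns the quadratic `δ - 2 a r - r ^ 2` into an
even function of `η`. -/
lemma integral_Ioi_posPow_eq_intervalIntegral {p δ ε : ℝ} (hδ : 0 < δ) (hε : 0 < ε) (a : ℝ) :
    ∫ r in Set.Ioi ε, posPow (p - 1) (δ - 2 * a * r - r ^ 2) * r ^ (-1 - 2 * p) =
      ∫ η in (-(a / δ))..(1 / ε - a / δ),
        (η + a / δ) * posPow (p - 1) (δ * η ^ 2 - (1 + a ^ 2 / δ)) := by
  set b := a / δ with hb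
  have hle : -b ≤ 1 / ε - b := by
    have : 0 < 1 / ε := by positivity
    linarith
  have himg : (fun η : ℝ => (η + b)⁻¹) '' Set.Ioo (-b) (1 / ε - b) = Set.Ioi ε := by
    ext r
    simp only [Set.mem_image, Set.mem_Ioo, Set.mem_Ioi]
    constructor
    · rintro ⟨η, ⟨h1, h2⟩, rfl⟩
      rw [lt_inv_comm₀ hε (by linarith), ← one_div]
      linarith
    · intro hr
      have hr0 := hε.trans hr
      refine ⟨r⁻¹ - b, ⟨?_, ?_⟩, by simp⟩
      · have := inv_pos.2 hr0
        linarith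
      · have := inv_strictAnti₀ hε hr
        rw [one_div]
        linarith
  have hder : ∀ η ∈ Set.Ioo (-b) (1 / ε - b), HasDerivWithinAt (fun η : ℝ => (η + b)⁻¹)
      (-1 / (η + b) ^ 2) (Set.Ioo (-b) (1 / ε - b)) η := fun η hη =>
    (((hasDerivAt_id η).add_const b).inv (by have := hη.1; simp only [id]; linarith)).hasDerivWithinAt
  have hinj : Set.InjOn (fun η : ℝ => (η + b)⁻¹) (Set.Ioo (-b) (1 / ε - b)) := fun x _ y _ h => by
    have := inv_injective h
    linarith
  rw [intervalIntegral.integral_of_le hle, integral_Ioc_eq_integral_Ioo, ← himg,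
    integral_image_eq_integral_abs_deriv_smul measurableSet_Ioo hder hinj]
  refine setIntegral_congr_fun measurableSet_Ioo fun η hη => ?_
  have ht : 0 < η + b := by linarith [hη.1]
  have hquad : δ - 2 * a * (η + b)⁻¹ - (η + b)⁻¹ ^ 2 =
      ((η + b) ^ 2)⁻¹ * (δ * η ^ 2 - (1 + a ^ 2 / δ)) := by
    have ha : a = δ * b := by rw [hb]; field_simp
    rw [ha]
    field_simp
    ring
  have hpow : |-1 / (η + b) ^ 2| * (((η + b) ^ 2)⁻¹ ^ (p - 1) * (η + b)⁻¹ ^ (-1 - 2 * p)) =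
      η + b := by
    rw [abs_div, abs_neg, abs_one, abs_of_pos (by positivity : 0 < (η + b) ^ 2), one_div,
      ← Real.rpow_natCast, ← Real.rpow_neg ht.le, ← Real.rpow_mul ht.le, ← Real.rpow_neg_one (η + b),
      ← Real.rpow_mul ht.le, ← Real.rpow_add ht, ← Real.rpow_add ht]
    convert Real.rpow_one (η + b) using 2
    push_cast
    ring
  simp only [smul_eq_mul]
  rw [hquad, posPow_mul (by positivity)]
  linear_combination posPow (p - 1) (δ * η ^ 2 - (1 + a ^ 2 / δ)) * hpow

/-- The factor `η` is integrated explicitly. The lower endpoint `-(a / δ)` may be moved to `0` since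
the even function of `η` produced by the substitution vanishes on `[-|a / δ|, |a / δ|]`. -/
lemma integral_Ioi_posPow_eq {p δ ε : ℝ} (hp₀ : 0 < p) (hp₁ : p < 1) (hδ : 0 < δ) (hε : 0 < ε)
    {a : ℝ} (ha : a / δ ≤ 1 / ε) :
    ∫ r in Set.Ioi ε, posPow (p - 1) (δ - 2 * a * r - r ^ 2) * r ^ (-1 - 2 * p) =
      posPow p (δ * (1 / ε - a / δ) ^ 2 - (1 + a ^ 2 / δ)) / (2 * δ * p) +
        a / δ * ∫ η in (0 : ℝ)..(1 / ε - a / δ), posPow (p - 1) (δ * η ^ 2 - (1 + a ^ 2 / δ)) := by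
  have hc : 0 < 1 + a ^ 2 / δ := by positivity
  have hM : 0 ≤ 1 / ε - a / δ := sub_nonneg.2 ha
  rw [integral_Ioi_posPow_eq_intervalIntegral hδ hε]
  set b := a / δ with hb
  have hab : δ * b ^ 2 = a ^ 2 / δ := by rw [hb]; field_simp
  set c := 1 + a ^ 2 / δ with hcdef
  have hzero : ∀ η ∈ Set.uIcc (-b) 0, (η + b) * posPow (p - 1) (δ * η ^ 2 - c) = 0 := by
    intro η hη
    have hsq : η ^ 2 ≤ b ^ 2 := by
      rw [Set.mem_uIcc] at hη
      rcases hη with h | h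
      · exact sq_le_sq' h.1 (by linarith)
      · rw [← neg_sq b]
        exact sq_le_sq' (by linarith) h.2
    have := mul_le_mul_of_nonneg_left hsq hδ.le
    rw [posPow_of_nonpos (by linarith) (by linarith), mul_zero]
  have h1 := integral_mul_posPow_quadratic hp₀ hp₁ hδ hc le_rfl hM
  have h2 := intervalIntegrable_posPow_quadratic hp₀ hp₁ hδ hc le_rfl hM
  have hi₀ : IntervalIntegrable (fun η => (η + b) * posPow (p - 1) (δ * η ^ 2 - c)) volume (-b) 0 :=
    (intervalIntegrable_const (c := (0 : ℝ))).congr fun η hη =>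
      (hzero η (Set.uIoc_subset_uIcc hη)).symm
  have hi₁ : IntervalIntegrable (fun η => (η + b) * posPow (p - 1) (δ * η ^ 2 - c)) volume 0
      (1 / ε - b) := by
    simp only [add_mul]
    exact h1.1.add (h2.const_mul b)
  rw [← intervalIntegral.integral_add_adjacent_intervals hi₀ hi₁,
    intervalIntegral.integral_congr hzero, intervalIntegral.integral_zero, zero_add]
  simp only [add_mul]
  rw [intervalIntegral.integral_add h1.1 (h2.const_mul b), h1.2,
    intervalIntegral.integral_const_mul,
    posPow_of_nonpos hp₀.ne' (by linarith : δ * (0 : ℝ) ^ 2 - c ≤ 0), sub_zero]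

/-- Second-order Bernoulli inequality for exponents in `[0, 1]`. -/
lemma abs_one_add_rpow_sub_le {p y : ℝ} (hp₀ : 0 ≤ p) (hp₁ : p ≤ 1) (hy : |y| ≤ 1 / 2) :
    |(1 + y) ^ p - 1 - p * y| ≤ y ^ 2 := by
  obtain ⟨hy₁, hy₂⟩ := abs_le.1 hy
  have hup := rpow_one_add_le_one_add_mul_self (by linarith : -1 ≤ y) hp₀ hp₁
  -- the lower bound comes from Bernoulli's inequality for the exponent `1 - p`
  have hlo := rpow_one_add_le_one_add_mul_self (by linarith : -1 ≤ y) (sub_nonneg.2 hp₁)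
    (by linarith : 1 - p ≤ 1)
  have hpos : 0 < 1 + y := by linarith
  have hprod : (1 + y) ^ p * (1 + y) ^ (1 - p) = 1 + y := by
    rw [← Real.rpow_add hpos]
    simp
  have hx := Real.rpow_pos_of_pos hpos p
  set x := (1 + y) ^ p
  have hpy := mul_nonneg (sub_nonneg.2 hp₁) (by linarith : 0 ≤ y + 1 / 2)
  have hden : 0 < 1 + (1 - p) * y := by linarith
  have h1 : 1 + y ≤ x * (1 + (1 - p) * y) := by
    rw [← hprod]
    exact mul_le_mul_of_nonneg_left hlo hx.le
  have h2 : (1 + p * y - y ^ 2) * (1 + (1 - p) * y) ≤ 1 + y := by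
    have e : 1 + y - (1 + p * y - y ^ 2) * (1 + (1 - p) * y) =
        y ^ 2 * (1 - p * (1 - p) + (1 - p) * y) := by ring
    have : 0 ≤ 1 - p * (1 - p) + (1 - p) * y := by linarith [sq_nonneg (p - 1 / 2), sq_nonneg p]
    linarith [mul_nonneg (sq_nonneg y) this]
  have h3 : 1 + p * y - y ^ 2 ≤ x := le_of_mul_le_mul_right (h2.trans h1) hden
  rw [abs_le]
  constructor <;> linarith [sq_nonneg y]

lemma quadratic_one_div_add {δ ε : ℝ} (hδ : 0 < δ) (hε : 0 < ε) (a t : ℝ) :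
    δ * (1 / ε + t) ^ 2 - (1 + a ^ 2 / δ) =
      (ε ^ 2)⁻¹ * (δ * (1 + (2 * t * ε + (t ^ 2 - (a / δ) ^ 2) * ε ^ 2 - ε ^ 2 / δ))) := by
  field_simp
  ring

lemma inv_sq_rpow {ε : ℝ} (hε : 0 < ε) (p : ℝ) : ((ε ^ 2)⁻¹) ^ p = ε ^ (-2 * p) := by
  rw [← Real.rpow_natCast, ← Real.rpow_neg hε.le, ← Real.rpow_mul hε.le]
  norm_num

/-- The primitive of the even function at the endpoints `1 / ε ± a / δ`, expanded in `ε`. -/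
lemma posPow_quadratic_endpoint {p δ ε a t : ℝ} (hp₀ : 0 ≤ p) (hp₁ : p ≤ 1) (hδ : 0 < δ)
    (hε : 0 < ε) (hε1 : ε ≤ 1) (hεδ : ε / δ ≤ 1 / 12) (ha : |a * (ε / δ)| ≤ ε / δ)
    (ht : |t| = |a / δ|) :
    posPow p (δ * (1 / ε + t) ^ 2 - (1 + a ^ 2 / δ)) =
      ε ^ (-2 * p) * (δ ^ p * (1 + (2 * t * ε - ε ^ 2 / δ)) ^ p) ∧
    |(1 + (2 * t * ε - ε ^ 2 / δ)) ^ p - 1 - p * (2 * t * ε - ε ^ 2 / δ)| ≤ 9 * (ε / δ) ^ 2 := by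
  have ht2 : t ^ 2 = (a / δ) ^ 2 := sq_eq_sq_iff_abs_eq_abs _ _ |>.2 ht
  have htε : |t * ε| ≤ ε / δ := by
    rw [abs_mul, ht, ← abs_mul]
    rwa [show a / δ * ε = a * (ε / δ) by ring]
  have hεδ0 : 0 < ε / δ := by positivity
  have hε2 : ε ^ 2 / δ = ε * (ε / δ) := by ring
  obtain ⟨h1, h2⟩ := abs_le.1 htε
  have h3 : ε * (ε / δ) ≤ ε / δ := mul_le_of_le_one_left hεδ0.le hε1
  have h4 : 0 < ε * (ε / δ) := by positivity
  have hyb : |2 * t * ε - ε ^ 2 / δ| ≤ 3 * (ε / δ) := by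
    rw [hε2, abs_le]
    constructor <;> linarith
  have hyhalf := hyb.trans (by linarith : 3 * (ε / δ) ≤ 1 / 2)
  refine ⟨?_, (abs_one_add_rpow_sub_le hp₀ hp₁ hyhalf).trans ?_⟩
  · have hpos : 0 ≤ 1 + (2 * t * ε - ε ^ 2 / δ) := by linarith [(abs_le.1 hyhalf).1]
    rw [quadratic_one_div_add hδ hε, ht2, sub_self, zero_mul, add_zero,
      posPow_mul (by positivity), inv_sq_rpow hε, posPow_of_nonneg (by positivity),
      Real.mul_rpow hδ.le hpos]
  · rw [← sq_abs]
    calc |2 * t * ε - ε ^ 2 / δ| ^ 2 ≤ (3 * (ε / δ)) ^ 2 := by gcongr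
      _ = 9 * (ε / δ) ^ 2 := by ring

/-- Near `η = 1 / ε` the quadratic is at least half its leading term. -/
lemma posPow_quadratic_le {p δ ε a m η : ℝ} (hp₁ : p ≤ 1) (hm : 0 < m) (hmδ : m ≤ δ)
    (hε : 0 < ε) (hε1 : ε ≤ 1) (hεδ : ε / δ ≤ 1 / 12) (ha : |a / δ * ε| ≤ ε / δ)
    (hη : |η - 1 / ε| ≤ |a / δ|) :
    posPow (p - 1) (δ * η ^ 2 - (1 + a ^ 2 / δ)) ≤
      ε ^ 2 * ε ^ (-2 * p) * (m / 2) ^ (p - 1) := by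
  have hδ := hm.trans_le hmδ
  have hq := quadratic_one_div_add hδ hε a (η - 1 / ε)
  have htε : |(η - 1 / ε) * ε| ≤ ε / δ := by
    refine le_trans ?_ ha
    rw [abs_mul, abs_mul]
    gcongr
  rw [add_sub_cancel] at hq
  generalize η - 1 / ε = t at hq hη htε
  generalize a / δ = b at hq hη ha
  obtain ⟨h1, h2⟩ := abs_le.1 htε
  obtain ⟨h3, h4⟩ := abs_le.1 ha
  have hlow : m / 2 ≤ δ * (1 + (2 * t * ε + (t ^ 2 - b ^ 2) * ε ^ 2 - ε ^ 2 / δ)) := by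
    have e0 : 0 < ε / δ := by positivity
    have e1 : (b * ε) ^ 2 ≤ (ε / δ) ^ 2 := sq_le_sq' h3 h4
    have e2 : 0 ≤ (t * ε) ^ 2 := sq_nonneg _
    have e3 : (ε / δ) ^ 2 ≤ (1 / 12) ^ 2 := by gcongr
    have e4 : ε * (ε / δ) ≤ 1 * (1 / 12) := by gcongr
    have e5 : 1 + (2 * t * ε + (t ^ 2 - b ^ 2) * ε ^ 2 - ε ^ 2 / δ) =
      1 + 2 * (t * ε) + (t * ε) ^ 2 - (b * ε) ^ 2 - ε * (ε / δ) := by ring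
    have hx : 1 / 2 ≤ 1 + (2 * t * ε + (t ^ 2 - b ^ 2) * ε ^ 2 - ε ^ 2 / δ) := by
      rw [e5]
      linarith
    calc m / 2 = m * (1 / 2) := by ring
      _ ≤ _ := by gcongr
  have hEp : ((ε ^ 2)⁻¹) ^ (p - 1) = ε ^ 2 * ε ^ (-2 * p) := by
    rw [Real.rpow_sub_one (by positivity), inv_sq_rpow hε]
    field_simp
  rw [hq, posPow_mul (by positivity), hEp, posPow_of_nonneg (by linarith)]
  exact mul_le_mul_of_nonneg_left
    (Real.rpow_le_rpow_of_nonpos (by positivity) hlow (by linarith)) (by positivity)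

/-- The two truncated integrals along opposite rays reproduce, up to `O(ε ^ (2 - 2 p))`, the
integral `2 δ ^ (p - 1) ∫_ε^∞ r ^ (-1 - 2 p) dr`, uniformly in the slope `a` and the height `δ`.
The terms of lower order in `ε` cancel between the rays `a` and `-a`. -/
lemma exists_bound_ray_integrals {p m : ℝ} (hp₀ : 0 < p) (hp₁ : p < 1) (hm : 0 < m) :
    ∃ C : ℝ, ∀ ε δ a : ℝ, 0 < ε → ε ≤ 1 → 12 * ε ≤ m → m ≤ δ → |a| ≤ 1 →
      |(∫ r in Set.Ioi ε, posPow (p - 1) (δ - 2 * a * r - r ^ 2) * r ^ (-1 - 2 * p)) +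
          (∫ r in Set.Ioi ε, posPow (p - 1) (δ + 2 * a * r - r ^ 2) * r ^ (-1 - 2 * p)) -
          δ ^ (p - 1) * ε ^ (-2 * p) / p| ≤ C * (ε ^ 2 * ε ^ (-2 * p)) := by
  refine ⟨m ^ (p - 1) / (2 * p) * (2 / m + 18 / m ^ 2) + 2 / m ^ 2 * (m / 2) ^ (p - 1),
    fun ε δ a hε hε1 hεm hmδ ha => ?_⟩
  have hδ : 0 < δ := hm.trans_le hmδ
  have hN : 2 / δ ≤ 1 / ε := by
    rw [div_le_div_iff₀ hδ hε]
    linarith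
  have habs : |a / δ| ≤ 1 / δ := by
    rw [abs_div, abs_of_pos hδ]
    gcongr
  obtain ⟨hb₁, hb₂⟩ := abs_le.1 habs
  have h2δ : 2 / δ = 1 / δ + 1 / δ := by ring
  have h1δ : 0 < 1 / δ := by positivity
  have hJ₁ := integral_Ioi_posPow_eq hp₀ hp₁ hδ hε (a := a) (by linarith)
  have hJ₂ := integral_Ioi_posPow_eq hp₀ hp₁ hδ hε (a := -a) (by rw [neg_div]; linarith)
  simp only [mul_neg, neg_mul, sub_neg_eq_add, neg_div, even_two.neg_pow] at hJ₂
  rw [hJ₁, hJ₂]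
  set N := 1 / ε with hNdef
  set b := a / δ with hb
  set c := 1 + a ^ 2 / δ with hcdef
  have hc : 0 < c := by positivity
  set f : ℝ → ℝ := fun η => posPow (p - 1) (δ * η ^ 2 - c) with hf
  -- the difference of the two remaining integrals is an integral over `[N - b, N + b]`
  have hsub : (∫ η in (0 : ℝ)..(N - b), f η) - ∫ η in (0 : ℝ)..(N + b), f η =
      -∫ η in (N - b)..(N + b), f η := by
    rw [← intervalIntegral.integral_interval_sub_left
      (intervalIntegrable_posPow_quadratic hp₀ hp₁ hδ hc le_rfl (by linarith : 0 ≤ N + b))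
      (intervalIntegrable_posPow_quadratic hp₀ hp₁ hδ hc le_rfl (by linarith : 0 ≤ N - b))]
    rw [neg_sub]
  set E := ε ^ (-2 * p) with hE
  have hEpos : 0 < E := Real.rpow_pos_of_pos hε _
  have hεδ : ε / δ ≤ 1 / 12 := by
    rw [div_le_div_iff₀ hδ (by norm_num)]
    linarith
  have hbε : |b * ε| ≤ ε / δ := by
    rw [abs_mul, abs_of_pos hε]
    calc |b| * ε ≤ 1 / δ * ε := by gcongr
      _ = ε / δ := by ring
  have haε : |a * (ε / δ)| ≤ ε / δ := by
    rwa [show a * (ε / δ) = b * ε by rw [hb]; ring]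
  obtain ⟨hP₁, hB₁⟩ :=
    posPow_quadratic_endpoint hp₀.le hp₁.le hδ hε hε1 hεδ haε (abs_neg (a / δ))
  obtain ⟨hP₂, hB₂⟩ := posPow_quadratic_endpoint hp₀.le hp₁.le hδ hε hε1 hεδ haε
    (rfl : |a / δ| = |a / δ|)
  rw [← sub_eq_add_neg] at hP₁
  have hint : |∫ η in (N - b)..(N + b), f η| ≤ (ε ^ 2 * E * (m / 2) ^ (p - 1)) * (2 * |b|) := by
    have hbd : ∀ η ∈ Set.uIoc (N - b) (N + b), ‖f η‖ ≤ ε ^ 2 * E * (m / 2) ^ (p - 1) := by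
      intro η hη
      have hη' := Set.uIoc_subset_uIcc hη
      rw [Real.norm_of_nonneg (posPow_nonneg _ _)]
      refine posPow_quadratic_le hp₁.le hm hmδ hε hε1 hεδ hbε ?_
      rw [Set.mem_uIcc] at hη'
      rw [abs_le]
      rcases hη' with h | h
      · have := le_abs_self b
        constructor <;> linarith
      · have := neg_abs_le b
        constructor <;> linarith
    have h := intervalIntegral.norm_integral_le_of_norm_le_const hbd
    rwa [Real.norm_eq_abs, show N + b - (N - b) = 2 * b by ring, abs_mul 2 b, abs_two] at h
  have hbm : |b| ≤ 1 / m := habs.trans (by gcongr)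
  have hδp : δ ^ (p - 1) ≤ m ^ (p - 1) := Real.rpow_le_rpow_of_nonpos hm hmδ (by linarith)
  have hδp' : δ ^ p = δ * δ ^ (p - 1) := by
    rw [Real.rpow_sub_one hδ.ne']
    field_simp
  set X := (1 + (2 * -b * ε - ε ^ 2 / δ)) ^ p
  set Y := (1 + (2 * b * ε - ε ^ 2 / δ)) ^ p
  have hXY : |X + Y - 2| ≤ ε ^ 2 * (2 / m + 18 / m ^ 2) := by
    have h1 : X + Y - 2 = (X - 1 - p * (2 * -b * ε - ε ^ 2 / δ)) +
        (Y - 1 - p * (2 * b * ε - ε ^ 2 / δ)) - 2 * p * (ε ^ 2 / δ) := by ring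
    have h2 : |2 * p * (ε ^ 2 / δ)| ≤ 2 * (ε ^ 2 / m) := by
      rw [abs_of_nonneg (by positivity)]
      have : p * (ε ^ 2 / δ) ≤ 1 * (ε ^ 2 / m) := by gcongr
      linarith
    have h3 : (ε / δ) ^ 2 ≤ (ε / m) ^ 2 := by gcongr
    rw [h1]
    refine (abs_sub _ _).trans ?_
    have h4 := abs_add_le (X - 1 - p * (2 * -b * ε - ε ^ 2 / δ))
      (Y - 1 - p * (2 * b * ε - ε ^ 2 / δ))
    have h5 : ε ^ 2 * (2 / m + 18 / m ^ 2) = 18 * (ε / m) ^ 2 + 2 * (ε ^ 2 / m) := by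
      field_simp
      ring
    rw [h5]
    linarith
  have hmain : posPow p (δ * (N - b) ^ 2 - c) / (2 * δ * p) + b * (∫ η in (0 : ℝ)..(N - b), f η) +
      (posPow p (δ * (N + b) ^ 2 - c) / (2 * δ * p) + -(b * ∫ η in (0 : ℝ)..(N + b), f η)) -
      δ ^ (p - 1) * E / p =
      δ ^ (p - 1) / (2 * p) * E * (X + Y - 2) - b * ∫ η in (N - b)..(N + b), f η := by
    rw [hP₁, hP₂, hδp', ← hE]
    have e : (∫ η in (N - b)..(N + b), f η) =
      (∫ η in (0 : ℝ)..(N + b), f η) - (∫ η in (0 : ℝ)..(N - b), f η) := by linarith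
    rw [e]
    field_simp
    ring
  rw [hmain]
  refine (abs_sub _ _).trans ?_
  rw [abs_mul, abs_mul b, abs_of_nonneg (by positivity : 0 ≤ δ ^ (p - 1) / (2 * p) * E)]
  calc δ ^ (p - 1) / (2 * p) * E * |X + Y - 2| + |b| * |∫ η in (N - b)..(N + b), f η|
      ≤ m ^ (p - 1) / (2 * p) * E * (ε ^ 2 * (2 / m + 18 / m ^ 2)) +
        1 / m * ((ε ^ 2 * E * (m / 2) ^ (p - 1)) * (2 * (1 / m))) := by
        refine add_le_add ?_ ?_
        · gcongr
        · refine mul_le_mul hbm (hint.trans ?_) (abs_nonneg _) (by positivity)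
          gcongr
    _ = _ := by
        field_simp

/-! ### Second differences along a line -/

lemma posPow_ray_le {p δ₁ δ₂ : ℝ} (hp₀ : 0 ≤ p) (h : δ₁ ≤ δ₂) (a r : ℝ) :
    |posPow p (δ₂ - 2 * a * r - r ^ 2) - posPow p (δ₁ - 2 * a * r - r ^ 2)| ≤
      posPow p (δ₂ + a ^ 2) := by
  have h1 : posPow p (δ₁ - 2 * a * r - r ^ 2) ≤ posPow p (δ₂ - 2 * a * r - r ^ 2) :=
    monotone_posPow hp₀ (by linarith)
  have h2 : posPow p (δ₂ - 2 * a * r - r ^ 2) ≤ posPow p (δ₂ + a ^ 2) :=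
    monotone_posPow hp₀ (by nlinarith [sq_nonneg (a + r)])
  have h3 := posPow_nonneg p (δ₁ - 2 * a * r - r ^ 2)
  rw [abs_of_nonneg (by linarith)]
  linarith

/-- Joint integrability of the kernel in the height `δ` and the radius `r`, and its integral over
`δ`. Integrating over `δ` first removes the singularity where the quadratic vanishes. -/
lemma integrable_ray_kernel {p δ₁ δ₂ ε : ℝ} (hp₀ : 0 < p) (hp₁ : p < 1) (h : δ₁ ≤ δ₂)
    (hε : 0 < ε) (a : ℝ) :
    Integrable (Function.uncurry fun δ r : ℝ =>
        posPow (p - 1) (δ - 2 * a * r - r ^ 2) * r ^ (-1 - 2 * p))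
      ((volume.restrict (Set.Ioc δ₁ δ₂)).prod (volume.restrict (Set.Ioi ε))) ∧
    ∀ r, ∫ δ in Set.Ioc δ₁ δ₂, posPow (p - 1) (δ - 2 * a * r - r ^ 2) * r ^ (-1 - 2 * p) =
      (posPow p (δ₂ - 2 * a * r - r ^ 2) - posPow p (δ₁ - 2 * a * r - r ^ 2)) / p *
        r ^ (-1 - 2 * p) := by
  have hslice : ∀ r : ℝ,
      IntegrableOn (fun δ => posPow (p - 1) (δ - 2 * a * r - r ^ 2)) (Set.Ioc δ₁ δ₂) ∧
      ∫ δ in Set.Ioc δ₁ δ₂, posPow (p - 1) (δ - 2 * a * r - r ^ 2) =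
        (posPow p (δ₂ - 2 * a * r - r ^ 2) - posPow p (δ₁ - 2 * a * r - r ^ 2)) / p := by
    intro r
    obtain ⟨h1, h2⟩ := integral_posPow_sub_one hp₀ hp₁ (2 * a * r + r ^ 2) δ₁ δ₂
    rw [intervalIntegrable_iff_integrableOn_Ioc_of_le h] at h1
    rw [intervalIntegral.integral_of_le h] at h2
    simp only [← sub_sub] at h1 h2
    exact ⟨h1, h2⟩
  have hint : ∀ r, ∫ δ in Set.Ioc δ₁ δ₂,
      posPow (p - 1) (δ - 2 * a * r - r ^ 2) * r ^ (-1 - 2 * p) =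
      (posPow p (δ₂ - 2 * a * r - r ^ 2) - posPow p (δ₁ - 2 * a * r - r ^ 2)) / p *
        r ^ (-1 - 2 * p) := fun r => by
    rw [integral_mul_const, (hslice r).2]
  refine ⟨?_, hint⟩
  have hmeas : Measurable (Function.uncurry fun δ r : ℝ =>
      posPow (p - 1) (δ - 2 * a * r - r ^ 2) * r ^ (-1 - 2 * p)) :=
    ((measurable_posPow _).comp
      (by fun_prop : Measurable fun z : ℝ × ℝ => z.1 - 2 * a * z.2 - z.2 ^ 2)).mul
      (measurable_snd.pow_const _)
  refine (integrable_prod_iff' hmeas.aestronglyMeasurable).2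
    ⟨Eventually.of_forall fun r => (hslice r).1.mul_const (r ^ (-1 - 2 * p)), ?_⟩
  have hpow : IntegrableOn (fun r : ℝ => r ^ (-1 - 2 * p)) (Set.Ioi ε) :=
    integrableOn_Ioi_rpow_of_lt (by linarith) hε
  refine Integrable.mono' (hpow.const_mul (posPow p (δ₂ + a ^ 2) / p))
    hmeas.norm.stronglyMeasurable.integral_prod_left'.aestronglyMeasurable ?_
  filter_upwards [ae_restrict_mem measurableSet_Ioi] with r hr
  have hr0 : 0 < r := hε.trans hr
  have hnn : ∀ δ, 0 ≤ posPow (p - 1) (δ - 2 * a * r - r ^ 2) * r ^ (-1 - 2 * p) := fun δ =>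
    mul_nonneg (posPow_nonneg _ _) (Real.rpow_nonneg hr0.le _)
  simp only [Function.uncurry, Real.norm_of_nonneg (hnn _)]
  rw [hint r, norm_mul, Real.norm_of_nonneg (Real.rpow_nonneg hr0.le _), norm_div,
    Real.norm_of_nonneg hp₀.le, Real.norm_eq_abs]
  have := posPow_ray_le hp₀.le h a r
  have := Real.rpow_nonneg hr0.le (-1 - 2 * p)
  gcongr

/-- The symmetric second difference, along a line, of `(δ₂ - ·)₊ ^ p - (δ₁ - ·)₊ ^ p` has a
truncated singular integral of order `ε ^ (2 - 2 p)`: by Fubini's theorem it is the average over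
`δ ∈ [δ₁, δ₂]` of the integrals estimated in `exists_bound_ray_integrals`. -/
lemma exists_bound_second_difference {p m δ₁ δ₂ : ℝ} (hp₀ : 0 < p) (hp₁ : p < 1) (hm : 0 < m)
    (h₁ : m ≤ δ₁) (h : δ₁ ≤ δ₂) :
    ∃ C : ℝ, ∀ ε a : ℝ, 0 < ε → ε ≤ 1 → 12 * ε ≤ m → |a| ≤ 1 →
      |∫ r in Set.Ioi ε,
        ((posPow p (δ₂ - 2 * a * r - r ^ 2) - posPow p (δ₁ - 2 * a * r - r ^ 2)) +
          (posPow p (δ₂ + 2 * a * r - r ^ 2) - posPow p (δ₁ + 2 * a * r - r ^ 2)) -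
          2 * (posPow p δ₂ - posPow p δ₁)) * r ^ (-1 - 2 * p)| ≤
        C * (ε ^ 2 * ε ^ (-2 * p)) := by
  obtain ⟨C, hC⟩ := exists_bound_ray_integrals hp₀ hp₁ hm
  refine ⟨p * (C * (δ₂ - δ₁)), fun ε a hε hε1 hεm ha => ?_⟩
  obtain ⟨hI₁, hD₁⟩ := integrable_ray_kernel hp₀ hp₁ h hε a
  obtain ⟨hI₂, hD₂⟩ := integrable_ray_kernel hp₀ hp₁ h hε (-a)
  simp only [mul_neg, neg_mul, sub_neg_eq_add] at hI₂ hD₂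
  have hpow : IntegrableOn (fun r : ℝ => r ^ (-1 - 2 * p)) (Set.Ioi ε) :=
    integrableOn_Ioi_rpow_of_lt (by linarith) hε
  have hpowval : ∫ r in Set.Ioi ε, r ^ (-1 - 2 * p) = ε ^ (-2 * p) / (2 * p) := by
    rw [integral_Ioi_rpow_of_lt (by linarith) hε, show -1 - 2 * p + 1 = -2 * p by ring,
      ← neg_div_neg_eq]
    congr 1 <;> ring
  obtain ⟨hI₀, hD₀⟩ := integral_posPow_sub_one hp₀ hp₁ 0 δ₁ δ₂
  rw [intervalIntegrable_iff_integrableOn_Ioc_of_le h] at hI₀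
  rw [intervalIntegral.integral_of_le h] at hD₀
  simp only [sub_zero] at hI₀ hD₀
  have hR₁ := hI₁.integral_prod_right
  have hR₂ := hI₂.integral_prod_right
  simp only [Function.uncurry, hD₁, hD₂] at hR₁ hR₂
  have hS₁ := integral_integral_swap hI₁
  have hS₂ := integral_integral_swap hI₂
  simp only [hD₁, hD₂] at hS₁ hS₂
  have hL₁ := hI₁.integral_prod_left
  have hL₂ := hI₂.integral_prod_left
  simp only [Function.uncurry] at hL₁ hL₂
  have key : (∫ r in Set.Ioi ε,
        ((posPow p (δ₂ - 2 * a * r - r ^ 2) - posPow p (δ₁ - 2 * a * r - r ^ 2)) +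
          (posPow p (δ₂ + 2 * a * r - r ^ 2) - posPow p (δ₁ + 2 * a * r - r ^ 2)) -
          2 * (posPow p δ₂ - posPow p δ₁)) * r ^ (-1 - 2 * p)) =
      p * ∫ δ in Set.Ioc δ₁ δ₂,
        ((∫ r in Set.Ioi ε, posPow (p - 1) (δ - 2 * a * r - r ^ 2) * r ^ (-1 - 2 * p)) +
          (∫ r in Set.Ioi ε, posPow (p - 1) (δ + 2 * a * r - r ^ 2) * r ^ (-1 - 2 * p)) -
          posPow (p - 1) δ * (ε ^ (-2 * p) / p)) := by
    have e1 : ∀ r : ℝ,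
        ((posPow p (δ₂ - 2 * a * r - r ^ 2) - posPow p (δ₁ - 2 * a * r - r ^ 2)) +
          (posPow p (δ₂ + 2 * a * r - r ^ 2) - posPow p (δ₁ + 2 * a * r - r ^ 2)) -
          2 * (posPow p δ₂ - posPow p δ₁)) * r ^ (-1 - 2 * p) =
        p * (((posPow p (δ₂ - 2 * a * r - r ^ 2) - posPow p (δ₁ - 2 * a * r - r ^ 2)) / p *
            r ^ (-1 - 2 * p) +
          (posPow p (δ₂ + 2 * a * r - r ^ 2) - posPow p (δ₁ + 2 * a * r - r ^ 2)) / p *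
            r ^ (-1 - 2 * p)) -
          2 * ((posPow p δ₂ - posPow p δ₁) / p) * r ^ (-1 - 2 * p)) := fun r => by
      field_simp
    simp only [e1]
    rw [integral_const_mul, integral_sub (hR₁.fun_add hR₂) (hpow.const_mul _), integral_add hR₁ hR₂,
      integral_const_mul, ← hS₁, ← hS₂, hpowval,
      integral_sub (hL₁.fun_add hL₂) (hI₀.mul_const _), integral_add hL₁ hL₂, integral_mul_const, hD₀]
    ring
  rw [key, abs_mul, abs_of_pos hp₀, mul_assoc]
  refine mul_le_mul_of_nonneg_left ?_ hp₀.le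
  have hb := norm_setIntegral_le_of_norm_le_const (μ := volume) (s := Set.Ioc δ₁ δ₂)
    (C := C * (ε ^ 2 * ε ^ (-2 * p))) (f := fun δ =>
        ((∫ r in Set.Ioi ε, posPow (p - 1) (δ - 2 * a * r - r ^ 2) * r ^ (-1 - 2 * p)) +
          (∫ r in Set.Ioi ε, posPow (p - 1) (δ + 2 * a * r - r ^ 2) * r ^ (-1 - 2 * p)) -
          posPow (p - 1) δ * (ε ^ (-2 * p) / p))) measure_Ioc_lt_top (fun δ hδ => by
      have hmδ : m ≤ δ := h₁.trans hδ.1.le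
      have := hC ε δ a hε hε1 hεm hmδ ha
      rwa [mul_div_assoc, ← posPow_of_nonneg (hm.le.trans hmδ)] at this)
  rw [Real.norm_eq_abs, Real.volume_real_Ioc_of_le h] at hb
  refine hb.trans (le_of_eq ?_)
  ring

/-! ### Polar coordinates -/

/-- A bound on the integrals along rays, taken against the polar density, bounds the integral. -/
lemma abs_integral_le_of_polar {E : Type*} [NormedAddCommGroup E] [NormedSpace ℝ E]
    [FiniteDimensional ℝ E] [MeasurableSpace E] [BorelSpace E] [Nontrivial E] (μ : Measure E)
    [μ.IsAddHaarMeasure] {G : E → ℝ} (hG : Integrable G μ) {K : ℝ}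
    (hK : ∀ θ : E, ‖θ‖ = 1 →
      |∫ r in Set.Ioi (0 : ℝ), r ^ (Module.finrank ℝ E - 1) * G (r • θ)| ≤ K) :
    |∫ x, G x ∂μ| ≤ K * μ.toSphere.real Set.univ := by
  have hmp := μ.measurePreserving_homeomorphUnitSphereProd
  have hemb : MeasurableEmbedding (homeomorphUnitSphereProd E) := Homeomorph.measurableEmbedding _
  have hcompl : MeasurableSet ({0}ᶜ : Set E) := (measurableSet_singleton _).compl
  -- `G` in polar coordinates
  set g : sphere (0 : E) 1 × Set.Ioi (0 : ℝ) → ℝ := fun z => G (z.2.1 • z.1.1) with hg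
  have hge : ∀ x : ({0}ᶜ : Set E), g (homeomorphUnitSphereProd E x) = G x := fun x => by
    have := congrArg Subtype.val ((homeomorphUnitSphereProd E).symm_apply_apply x)
    rw [homeomorphUnitSphereProd_symm_apply_coe] at this
    simp only [hg]
    rw [this]
  have hint : Integrable g (μ.toSphere.prod (.volumeIoiPow (Module.finrank ℝ E - 1))) := by
    rw [← hmp.integrable_comp_emb hemb]
    have : (g ∘ homeomorphUnitSphereProd E) = G ∘ Subtype.val := funext hge
    rw [this, ← integrableOn_iff_comap_subtypeVal hcompl]
    exact hG.integrableOn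
  have heq : ∫ x, G x ∂μ =
      ∫ θ, ∫ r, g (θ, r) ∂.volumeIoiPow (Module.finrank ℝ E - 1) ∂μ.toSphere := by
    rw [← integral_prod _ hint, ← hmp.integral_comp hemb]
    simp only [hge]
    rw [integral_subtype_comap hcompl, restrict_compl_singleton]
  rw [heq, ← Real.norm_eq_abs]
  refine norm_integral_le_of_norm_le_const (Eventually.of_forall fun θ => ?_)
  have hray : ∫ r, g (θ, r) ∂.volumeIoiPow (Module.finrank ℝ E - 1) =
      ∫ r in Set.Ioi (0 : ℝ), r ^ (Module.finrank ℝ E - 1) * G (r • θ.1) := by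
    simp only [Measure.volumeIoiPow, ENNReal.ofReal]
    rw [integral_withDensity_eq_integral_smul
      ((measurable_subtype_coe.pow_const _).real_toNNReal),
      integral_subtype_comap measurableSet_Ioi
        fun a : ℝ => Real.toNNReal (a ^ (Module.finrank ℝ E - 1)) • G (a • θ.1)]
    refine setIntegral_congr_fun measurableSet_Ioi fun r hr => ?_
    rw [NNReal.smul_def, Real.coe_toNNReal _ (pow_nonneg (le_of_lt hr) _), smul_eq_mul]
  rw [hray]
  exact hK θ.1 (by simp)

lemma integrableOn_fracLaplacianIntegrand {d : ℕ} {α : ℝ} (hα : 0 < α)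
    {u : EuclideanSpace ℝ (Fin d) → ℝ} (hu : Continuous u) {M : ℝ} (hM : ∀ y, |u y| ≤ M)
    (x : EuclideanSpace ℝ (Fin d)) {ε : ℝ} (hε : 0 < ε) :
    IntegrableOn (fracLaplacianIntegrand α u x) {y | ε < ‖y - x‖} volume := by
  have hdα : 0 < (d : ℝ) + α := by positivity
  have hmeas : Measurable (fracLaplacianIntegrand α u x) := by
    unfold fracLaplacianIntegrand
    exact (hu.measurable.sub_const _).div ((by fun_prop : Measurable fun y => ‖y - x‖).pow_const _)
  have hJ : Integrable (fun y : EuclideanSpace ℝ (Fin d) => (1 + ‖y - x‖) ^ (-((d : ℝ) + α))) :=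
    (integrable_one_add_norm (by simpa using hα)).comp_sub_right x
  refine Integrable.mono' ((hJ.const_mul ((M + M) * (1 / ε + 1) ^ ((d : ℝ) + α))).integrableOn)
    hmeas.aestronglyMeasurable ?_
  filter_upwards [ae_restrict_mem (measurableSet_lt measurable_const (by fun_prop))] with y hy
  have hy : ε < ‖y - x‖ := hy
  have hpos : 0 < ‖y - x‖ := hε.trans hy
  have hM0 : 0 ≤ M := (abs_nonneg _).trans (hM x)
  rw [fracLaplacianIntegrand, norm_div, Real.norm_of_nonneg (Real.rpow_nonneg hpos.le _),
    div_eq_mul_inv, mul_assoc]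
  refine mul_le_mul ?_ ?_ (by positivity) (by positivity)
  · exact (norm_sub_le _ _).trans (add_le_add (hM y) (hM x))
  · rw [Real.rpow_neg (by positivity), ← div_eq_mul_inv, ← Real.div_rpow (by positivity)
      (by positivity), ← Real.inv_rpow hpos.le]
    refine Real.rpow_le_rpow (by positivity) ?_ hdα.le
    rw [le_div_iff₀ (by positivity), inv_mul_le_iff₀ hpos]
    have : 1 ≤ 1 / ε * ‖y - x‖ := by
      rw [one_div, ← div_eq_inv_mul, one_le_div hε]
      exact hy.le
    linarith

/-- If the second differences of a bounded continuous function along all lines through `x` have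
truncated singular integrals of order `ε ^ (2 - α)`, then the fractional Laplacian at `x` exists
and vanishes. -/
lemma hasFracLaplacianAt_zero_of_second_difference {d : ℕ} (hd : 1 ≤ d) {α : ℝ} (hα₀ : 0 < α)
    (hα₂ : α < 2) {u : EuclideanSpace ℝ (Fin d) → ℝ} (hu : Continuous u) {M : ℝ}
    (hM : ∀ y, |u y| ≤ M) {x : EuclideanSpace ℝ (Fin d)} {C : ℝ}
    (hC : ∀ᶠ ε in 𝓝[>] (0 : ℝ), ∀ θ : EuclideanSpace ℝ (Fin d), ‖θ‖ = 1 →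
      |∫ r in Set.Ioi ε, (u (x + r • θ) + u (x - r • θ) - 2 * u x) * r ^ (-1 - α)| ≤
        C * ε ^ (2 - α)) :
    HasFracLaplacianAt α u 0 x := by
  refine ⟨fun ε hε => integrableOn_fracLaplacianIntegrand hα₀ hu hM x hε, ?_⟩
  have : Nonempty (Fin d) := ⟨⟨0, hd⟩⟩
  set σ := (volume : Measure (EuclideanSpace ℝ (Fin d))).toSphere.real Set.univ
  have hlim : Tendsto (fun ε : ℝ => |fracLaplacianConst d α| * (C / 2 * ε ^ (2 - α) * σ))
      (𝓝[>] 0) (𝓝 0) := by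
    have h := (Real.continuousAt_rpow_const 0 (2 - α) (Or.inr (by linarith))).tendsto
    rw [Real.zero_rpow (by linarith)] at h
    have h2 := ((h.const_mul (C / 2)).mul_const σ).const_mul |fracLaplacianConst d α|
    simp only [mul_zero, zero_mul] at h2
    exact h2.mono_left nhdsWithin_le_nhds
  refine squeeze_zero_norm' ?_ hlim
  filter_upwards [hC, self_mem_nhdsWithin] with ε hCε hε
  have hε : 0 < ε := hε
  rw [norm_mul, Real.norm_eq_abs]
  refine mul_le_mul_of_nonneg_left ?_ (abs_nonneg _)
  set S : Set (EuclideanSpace ℝ (Fin d)) := {y | ε < ‖y - x‖}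
  have hS : MeasurableSet S := measurableSet_lt measurable_const (by fun_prop)
  set F := S.indicator (fracLaplacianIntegrand α u x)
  have hF : Integrable F :=
    (integrable_indicator_iff hS).2 (integrableOn_fracLaplacianIntegrand hα₀ hu hM x hε)
  have hG₁ : Integrable fun h => F (x + h) := hF.comp_add_left x
  have hG₂ : Integrable fun h => F (x - h) := hF.comp_sub_left x
  have hsym : ∫ y in S, fracLaplacianIntegrand α u x y =
      ∫ h, (F (x + h) + F (x - h)) / 2 := by
    rw [integral_div, integral_add hG₁ hG₂, integral_add_left_eq_self,
      integral_sub_left_eq_self, integral_indicator hS]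
    ring
  rw [hsym, Real.norm_eq_abs]
  refine abs_integral_le_of_polar volume ((hG₁.fun_add hG₂).div_const 2) fun θ hθ => ?_
  have hray : ∫ r in Set.Ioi (0 : ℝ), r ^ (Module.finrank ℝ (EuclideanSpace ℝ (Fin d)) - 1) *
      ((F (x + r • θ) + F (x - r • θ)) / 2) =
      1 / 2 * ∫ r in Set.Ioi ε, (u (x + r • θ) + u (x - r • θ) - 2 * u x) * r ^ (-1 - α) := by
    rw [← integral_const_mul, ← Set.inter_eq_right.2 (Set.Ioi_subset_Ioi hε.le),
      ← setIntegral_indicator measurableSet_Ioi]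
    refine setIntegral_congr_fun measurableSet_Ioi fun r hr => ?_
    have hr : 0 < r := hr
    have hn : ‖r • θ‖ = r := by rw [norm_smul, hθ, mul_one, Real.norm_of_nonneg hr.le]
    have hmem₁ : x + r • θ ∈ S ↔ ε < r := by
      simp [S, hn]
    have hmem₂ : x - r • θ ∈ S ↔ ε < r := by
      simp [S, hn]
    by_cases h : ε < r
    · simp only [F]
      rw [Set.indicator_of_mem (hmem₁.2 h), Set.indicator_of_mem (hmem₂.2 h),
        Set.indicator_of_mem (Set.mem_Ioi.2 h)]
      simp only [fracLaplacianIntegrand, add_sub_cancel_left, sub_sub_cancel_left, norm_neg, hn,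
        finrank_euclideanSpace, Fintype.card_fin]
      have hp : r ^ (d - 1) / r ^ ((d : ℝ) + α) = r ^ (-1 - α) := by
        rw [← Real.rpow_natCast, ← Real.rpow_sub hr, Nat.cast_sub hd]
        congr 1
        push_cast
        ring
      rw [← hp]
      ring
    · simp only [F]
      rw [Set.indicator_of_notMem (mt hmem₁.1 h), Set.indicator_of_notMem (mt hmem₂.1 h),
        Set.indicator_of_notMem (mt Set.mem_Ioi.1 h)]
      simp
  rw [hray, abs_mul, abs_of_pos (by norm_num : (0 : ℝ) < 1 / 2)]
  have := hCε θ hθ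
  linarith

/-! ### A family of `α`-harmonic functions -/

/-- The function `y ↦ (B - |y| ^ 2)₊ ^ p - (A - |y| ^ 2)₊ ^ p`. For `p = α / 2`, each of the two
terms has a constant fractional Laplacian in its ball of positivity, and the two constants agree. -/
noncomputable def powDiff {d : ℕ} (p A B : ℝ) (y : EuclideanSpace ℝ (Fin d)) : ℝ :=
  posPow p (B - ‖y‖ ^ 2) - posPow p (A - ‖y‖ ^ 2)

lemma continuous_powDiff {d : ℕ} {p : ℝ} (hp : 0 ≤ p) (A B : ℝ) :
    Continuous (powDiff p A B : EuclideanSpace ℝ (Fin d) → ℝ) := by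
  have h := continuous_posPow hp
  unfold powDiff
  fun_prop

lemma abs_powDiff_le {d : ℕ} {p A B : ℝ} (hp : 0 ≤ p) (hAB : A ≤ B)
    (y : EuclideanSpace ℝ (Fin d)) : |powDiff p A B y| ≤ posPow p B := by
  have h1 : posPow p (A - ‖y‖ ^ 2) ≤ posPow p (B - ‖y‖ ^ 2) := monotone_posPow hp (by linarith)
  have h2 : posPow p (B - ‖y‖ ^ 2) ≤ posPow p B :=
    monotone_posPow hp (by linarith [sq_nonneg ‖y‖])
  have h3 := posPow_nonneg p (A - ‖y‖ ^ 2)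
  rw [powDiff, abs_of_nonneg (by linarith)]
  linarith

lemma contDiffOn_powDiff {d : ℕ} {p A B : ℝ} (hA : 1 ≤ A) (hAB : A ≤ B) :
    ContDiffOn ℝ ∞ (powDiff p A B : EuclideanSpace ℝ (Fin d) → ℝ) (ball 0 1) := by
  have hlt : ∀ y ∈ ball (0 : EuclideanSpace ℝ (Fin d)) 1, ‖y‖ ^ 2 < 1 := fun y hy => by
    rw [mem_ball_zero_iff] at hy
    exact pow_lt_one₀ (norm_nonneg y) hy two_ne_zero
  have key : ∀ s : ℝ, 1 ≤ s → ContDiffOn ℝ ∞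
      (fun y : EuclideanSpace ℝ (Fin d) => posPow p (s - ‖y‖ ^ 2)) (ball 0 1) := fun s hs => by
    have h : ContDiffOn ℝ ∞ (fun y : EuclideanSpace ℝ (Fin d) => (s - ‖y‖ ^ 2) ^ p) (ball 0 1) :=
      ((contDiff_const.sub (contDiff_norm_sq ℝ)).contDiffOn).rpow_const_of_ne fun y hy => by
        have := hlt y hy
        linarith
    exact h.congr fun y hy => posPow_of_nonneg (by linarith [hlt y hy])
  exact (key B (hA.trans hAB)).sub (key A hA)

/-- Along a line through `x` in direction `θ`, `powDiff` depends on `θ` only through `⟪x, θ⟫`, so the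
one-dimensional estimate applies uniformly in `θ`. -/
lemma isAlphaHarmonicOn_powDiff {d : ℕ} (hd : 1 ≤ d) {α A B : ℝ} (hα₀ : 0 < α) (hα₂ : α < 2)
    (hA : 1 ≤ A) (hAB : A ≤ B) :
    IsAlphaHarmonicOn α (powDiff (α / 2) A B : EuclideanSpace ℝ (Fin d) → ℝ) (ball 0 1) := by
  intro x hx
  rw [mem_ball_zero_iff] at hx
  have hp₀ : 0 < α / 2 := by linarith
  have hp₁ : α / 2 < 1 := by linarith
  have hm : 0 < A - ‖x‖ ^ 2 := by
    have := pow_lt_one₀ (norm_nonneg x) hx two_ne_zero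
    linarith
  obtain ⟨C, hC⟩ := exists_bound_second_difference hp₀ hp₁ hm le_rfl
    (sub_le_sub_right hAB (‖x‖ ^ 2))
  refine hasFracLaplacianAt_zero_of_second_difference hd hα₀ hα₂ (continuous_powDiff hp₀.le A B)
    (abs_powDiff_le hp₀.le hAB) (C := C) ?_
  have hsmall : (0 : ℝ) < min 1 ((A - ‖x‖ ^ 2) / 12) := by positivity
  filter_upwards [Ioo_mem_nhdsGT hsmall] with ε hε θ hθ
  obtain ⟨hε0, hε1⟩ := hε
  obtain ⟨hε1, hε2⟩ := lt_min_iff.1 hε1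
  have ha : |inner ℝ x θ| ≤ 1 := by
    have := abs_real_inner_le_norm x θ
    rw [hθ, mul_one] at this
    exact this.trans hx.le
  have h := hC ε (inner ℝ x θ) hε0 hε1.le (by linarith) ha
  have hpow : ε ^ 2 * ε ^ (-2 * (α / 2)) = ε ^ (2 - α) := by
    rw [← Real.rpow_natCast, ← Real.rpow_add hε0]
    congr 1
    push_cast
    ring
  rw [hpow] at h
  convert h using 2
  refine setIntegral_congr_fun measurableSet_Ioi fun r _ => ?_
  have hadd : ‖x + r • θ‖ ^ 2 = ‖x‖ ^ 2 + 2 * inner ℝ x θ * r + r ^ 2 := by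
    rw [norm_add_sq_real, norm_smul, hθ, inner_smul_right, mul_one, Real.norm_eq_abs, sq_abs]
    ring
  have hsub : ‖x - r • θ‖ ^ 2 = ‖x‖ ^ 2 - 2 * inner ℝ x θ * r + r ^ 2 := by
    rw [norm_sub_sq_real, norm_smul, hθ, inner_smul_right, mul_one, Real.norm_eq_abs, sq_abs]
    ring
  simp only [powDiff, hadd, hsub]
  have e₁ : ∀ s : ℝ, s - (‖x‖ ^ 2 + 2 * inner ℝ x θ * r + r ^ 2) =
    s - ‖x‖ ^ 2 - 2 * inner ℝ x θ * r - r ^ 2 := fun s => by ring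
  have e₂ : ∀ s : ℝ, s - (‖x‖ ^ 2 - 2 * inner ℝ x θ * r + r ^ 2) =
    s - ‖x‖ ^ 2 + 2 * inner ℝ x θ * r - r ^ 2 := fun s => by ring
  rw [e₁, e₁, e₂, e₂, show -1 - 2 * (α / 2) = -1 - α by ring]

lemma IsAlphaHarmonicOn.const_mul {d : ℕ} {α : ℝ} {u : EuclideanSpace ℝ (Fin d) → ℝ}
    {D : Set (EuclideanSpace ℝ (Fin d))} (hu : IsAlphaHarmonicOn α u D) (c : ℝ) :
    IsAlphaHarmonicOn α (fun y => c * u y) D := by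
  intro x hx
  obtain ⟨hi, ht⟩ := hu x hx
  have e : fracLaplacianIntegrand α (fun y => c * u y) x =
      fun y => c * fracLaplacianIntegrand α u x y := by
    funext y
    simp only [fracLaplacianIntegrand]
    ring
  refine ⟨fun ε hε => ?_, ?_⟩
  · rw [e]
    exact (hi ε hε).const_mul c
  · have h := ht.const_mul c
    rw [mul_zero] at h
    refine h.congr fun ε => ?_
    rw [e, integral_const_mul]
    ring

lemma IsAlphaHarmonicOn.sub {d : ℕ} {α : ℝ} {u v : EuclideanSpace ℝ (Fin d) → ℝ}
    {D : Set (EuclideanSpace ℝ (Fin d))} (hu : IsAlphaHarmonicOn α u D)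
    (hv : IsAlphaHarmonicOn α v D) : IsAlphaHarmonicOn α (fun y => u y - v y) D := by
  intro x hx
  obtain ⟨hi, ht⟩ := hu x hx
  obtain ⟨hi', ht'⟩ := hv x hx
  have e : fracLaplacianIntegrand α (fun y => u y - v y) x =
      fun y => fracLaplacianIntegrand α u x y - fracLaplacianIntegrand α v x y := by
    funext y
    simp only [fracLaplacianIntegrand]
    ring
  refine ⟨fun ε hε => ?_, ?_⟩
  · rw [e]
    exact (hi ε hε).sub (hi' ε hε)
  · have h := ht.sub ht'
    rw [sub_zero] at h
    refine h.congr' ?_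
    filter_upwards [self_mem_nhdsWithin] with ε hε
    rw [e, integral_sub (hi ε hε) (hi' ε hε)]
    ring

/-! ### The counterexample -/

/-- After normalization at `t = 0`, the difference over `[1, 2]` grows faster in `t` than the one
over `[2, 3]`: the function `s ↦ (s - t) ^ p - (1 - t / 2) ^ (p - 1) s ^ p` has its maximum at
`s = 2`. -/
lemma normalized_rpow_difference_lt {p t : ℝ} (hp₀ : 0 < p) (hp₁ : p < 1) (ht₀ : 0 < t)
    (ht₁ : t ≤ 1) :
    ((3 - t) ^ p - (2 - t) ^ p) / (3 ^ p - 2 ^ p) <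
      ((2 - t) ^ p - (1 - t) ^ p) / (2 ^ p - 1 ^ p) := by
  set c := (1 - t / 2) ^ (p - 1) with hc
  have hder : ∀ s : ℝ, 1 < s → HasDerivAt (fun s : ℝ => (s - t) ^ p - c * s ^ p)
      (p * s ^ (p - 1) * ((1 - t / s) ^ (p - 1) - c)) s := by
    intro s hs
    have hs0 : 0 < s := by linarith
    have hst : 0 < s - t := by linarith
    have h1 := ((hasDerivAt_id s).sub_const t).rpow_const (p := p) (Or.inl hst.ne')
    have h2 := (Real.hasDerivAt_rpow_const (p := p) (Or.inl hs0.ne')).const_mul c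
    refine (h1.sub h2).congr_deriv ?_
    have h3 : s - t = s * (1 - t / s) := by field_simp
    have h4 : 0 ≤ 1 - t / s := by
      rw [sub_nonneg, div_le_one hs0]
      linarith
    simp only [id]
    rw [h3, Real.mul_rpow hs0.le h4]
    ring
  have hcont : ContinuousOn (fun s : ℝ => (s - t) ^ p - c * s ^ p) (Set.Ici 1) :=
    (((continuous_id.sub continuous_const).rpow_const fun _ => Or.inr hp₀.le).sub
      (continuous_const.mul (continuous_id.rpow_const fun _ => Or.inr hp₀.le))).continuousOn
  have hmono : StrictMonoOn (fun s : ℝ => (s - t) ^ p - c * s ^ p) (Set.Icc 1 2) := by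
    refine strictMonoOn_of_deriv_pos (convex_Icc _ _) (hcont.mono Set.Icc_subset_Ici_self)
      fun s hs => ?_
    rw [interior_Icc] at hs
    rw [(hder s hs.1).deriv]
    have hs0 : 0 < s := by linarith [hs.1]
    have h1 : 0 < 1 - t / s := by
      rw [sub_pos, div_lt_one hs0]
      linarith [hs.1]
    have h2 : 1 - t / s < 1 - t / 2 := by
      have : t / 2 < t / s := div_lt_div_of_pos_left ht₀ hs0 hs.2
      linarith
    have h3 : c < (1 - t / s) ^ (p - 1) := Real.rpow_lt_rpow_of_neg h1 h2 (by linarith)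
    have := sub_pos.2 h3
    positivity
  have hanti : StrictAntiOn (fun s : ℝ => (s - t) ^ p - c * s ^ p) (Set.Icc 2 3) := by
    refine strictAntiOn_of_deriv_neg (convex_Icc _ _)
      (hcont.mono (Set.Icc_subset_Ici_self.trans (Set.Ici_subset_Ici.2 one_le_two)))
      fun s hs => ?_
    rw [interior_Icc] at hs
    rw [(hder s (by linarith [hs.1])).deriv]
    have hs0 : 0 < s := by linarith [hs.1]
    have h2 : 1 - t / 2 < 1 - t / s := by
      have : t / s < t / 2 := div_lt_div_of_pos_left ht₀ two_pos hs.1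
      linarith
    have h3 : (1 - t / s) ^ (p - 1) < c :=
      Real.rpow_lt_rpow_of_neg (by linarith) h2 (by linarith)
    have h4 : 0 < p * s ^ (p - 1) := by positivity
    exact mul_neg_of_pos_of_neg h4 (sub_neg.2 h3)
  have h12 := hmono (Set.left_mem_Icc.2 one_le_two) (Set.right_mem_Icc.2 one_le_two) one_lt_two
  have h23 := hanti (Set.left_mem_Icc.2 (by norm_num : (2 : ℝ) ≤ 3))
    (Set.right_mem_Icc.2 (by norm_num)) (by norm_num : (2 : ℝ) < 3)
  simp only at h12 h23
  have hd₁ : 0 < (2 : ℝ) ^ p - 1 ^ p :=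
    sub_pos.2 (Real.rpow_lt_rpow zero_le_one one_lt_two hp₀)
  have hd₂ : 0 < (3 : ℝ) ^ p - 2 ^ p :=
    sub_pos.2 (Real.rpow_lt_rpow zero_le_two (by norm_num) hp₀)
  calc ((3 - t) ^ p - (2 - t) ^ p) / (3 ^ p - 2 ^ p) < c := by
        rw [div_lt_iff₀ hd₂]
        linarith
    _ < _ := by
        rw [lt_div_iff₀ hd₁]
        linarith

/-- A bounded continuous function, smooth and `α`-harmonic in the unit ball, that is radial and has
a strict zero minimum over the closed unit ball at the origin. -/
lemma exists_alphaHarmonic_strict_min {d : ℕ} (hd : 1 ≤ d) {α : ℝ} (hα₀ : 0 < α) (hα₂ : α < 2) :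
    ∃ u : EuclideanSpace ℝ (Fin d) → ℝ, Continuous u ∧ (∃ M : ℝ, ∀ x, |u x| ≤ M) ∧
      ContDiffOn ℝ ∞ u (ball 0 1) ∧ IsAlphaHarmonicOn α u (ball 0 1) ∧
      (∀ x, x ≠ 0 → ‖x‖ ≤ 1 → 0 < u x) ∧ u 0 = 0 ∧ ∀ x y, ‖x‖ = ‖y‖ → u x = u y := by
  have hp₀ : 0 < α / 2 := by linarith
  have hp₁ : α / 2 < 1 := by linarith
  set p := α / 2 with hp
  have hd₁ : 0 < (2 : ℝ) ^ p - 1 ^ p :=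
    sub_pos.2 (Real.rpow_lt_rpow zero_le_one one_lt_two hp₀)
  have hd₂ : 0 < (3 : ℝ) ^ p - 2 ^ p :=
    sub_pos.2 (Real.rpow_lt_rpow zero_le_two (by norm_num) hp₀)
  refine ⟨fun x => (2 ^ p - 1 ^ p)⁻¹ * powDiff p 1 2 x - (3 ^ p - 2 ^ p)⁻¹ * powDiff p 2 3 x,
    ?_, ⟨(2 ^ p - 1 ^ p)⁻¹ * posPow p 2 + (3 ^ p - 2 ^ p)⁻¹ * posPow p 3, fun x => ?_⟩,
    ?_, ?_, fun x hx0 hx1 => ?_, ?_, fun x y hxy => ?_⟩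
  · exact (continuous_const.mul (continuous_powDiff hp₀.le 1 2)).sub
      (continuous_const.mul (continuous_powDiff hp₀.le 2 3))
  · refine (abs_sub _ _).trans ?_
    rw [abs_mul, abs_mul, abs_of_pos (inv_pos.2 hd₁), abs_of_pos (inv_pos.2 hd₂)]
    gcongr
    · exact abs_powDiff_le hp₀.le one_le_two x
    · exact abs_powDiff_le hp₀.le (by norm_num) x
  · exact (contDiffOn_const.mul (contDiffOn_powDiff le_rfl one_le_two)).sub
      (contDiffOn_const.mul (contDiffOn_powDiff one_le_two (by norm_num)))
  · exact ((isAlphaHarmonicOn_powDiff hd hα₀ hα₂ le_rfl one_le_two).const_mul _).sub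
      ((isAlphaHarmonicOn_powDiff hd hα₀ hα₂ one_le_two (by norm_num)).const_mul _)
  · have ht₀ : 0 < ‖x‖ ^ 2 := by positivity
    have ht₁ : ‖x‖ ^ 2 ≤ 1 := pow_le_one₀ (norm_nonneg x) hx1
    have h := normalized_rpow_difference_lt hp₀ hp₁ ht₀ ht₁
    rw [div_eq_inv_mul, div_eq_inv_mul] at h
    simp only [powDiff]
    rw [posPow_of_nonneg (by linarith : 0 ≤ 1 - ‖x‖ ^ 2),
      posPow_of_nonneg (by linarith : 0 ≤ 2 - ‖x‖ ^ 2),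
      posPow_of_nonneg (by linarith : 0 ≤ 3 - ‖x‖ ^ 2)]
    exact sub_pos.2 h
  · simp only [powDiff, norm_zero, ne_eq, OfNat.ofNat_ne_zero, not_false_eq_true, zero_pow, sub_zero]
    rw [posPow_of_nonneg zero_le_one, posPow_of_nonneg zero_le_two, posPow_of_nonneg zero_le_three,
      inv_mul_cancel₀ hd₁.ne', inv_mul_cancel₀ hd₂.ne', sub_self]
  · simp only [powDiff, hxy]

theorem mainTheorem11 (d : ℕ) (hd : 1 ≤ d) (α : ℝ) (hα₀ : 0 < α) (hα₂ : α < 2) :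
    (∃ u : EuclideanSpace ℝ (Fin d) → ℝ,
      Continuous u ∧
      (∃ M : ℝ, ∀ x, |u x| ≤ M) ∧
      ContDiffOn ℝ ∞ u (ball 0 1) ∧
      IsAlphaHarmonicOn α u (ball 0 1) ∧
      (∀ x ∈ ball (0 : EuclideanSpace ℝ (Fin d)) 1 \ {0}, 0 < u x) ∧
      u 0 = 0) ∧
    ¬ LocalHarnackInequality d α ∧
    ¬ LocalWeakMaximumPrinciple d α ∧
    ¬ LocalStrongMaximumPrinciple d α := by
  obtain ⟨u, hcont, hbdd, hsmooth, hharm, hpos, hzero, hrad⟩ :=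
    exists_alphaHarmonic_strict_min hd hα₀ hα₂
  have hcontN : Continuous fun y => -1 * u y := continuous_const.mul hcont
  have hharmN := hharm.const_mul (-1)
  set e : EuclideanSpace ℝ (Fin d) := EuclideanSpace.single ⟨0, hd⟩ 1 with he
  have hen : ‖e‖ = 1 := by simp [he]
  have hxn : ‖(1 / 4 : ℝ) • e‖ = 1 / 4 := by
    rw [norm_smul, hen]
    norm_num
  have hxpos : 0 < u ((1 / 4 : ℝ) • e) :=
    hpos _ (norm_pos_iff.1 (by rw [hxn]; norm_num)) (by rw [hxn]; norm_num)
  refine ⟨⟨u, hcont, hbdd, hsmooth, hharm, fun x hx => hpos x hx.2 ?_, hzero⟩, ?_, ?_, ?_⟩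
  · exact (mem_ball_zero_iff.1 hx.1).le
  · rintro ⟨c, _, hH⟩
    have hnn : ∀ x ∈ ball 0 1, 0 ≤ u x := fun x hx => by
      by_cases h : x = 0
      · rw [h, hzero]
      · exact (hpos x h (mem_ball_zero_iff.1 hx).le).le
    have h := hH u hcont hharm hnn ((1 / 4 : ℝ) • e)
      (by rw [mem_ball_zero_iff, hxn]; norm_num) 0 (mem_ball_self (by norm_num))
    rw [hzero, mul_zero] at h
    linarith
  · intro hW
    have h := hW _ hcontN hharmN (-u e)
      (fun y hy => by rw [hrad y e (by rw [mem_sphere_zero_iff_norm.1 hy, hen]), neg_one_mul])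
      0 (mem_ball_self one_pos)
    have he0 := hpos e (norm_pos_iff.1 (by rw [hen]; norm_num)) hen.le
    rw [hzero] at h
    linarith
  · intro hS
    have h := hS _ hcontN hharmN 0 (mem_ball_self one_pos)
      (fun x hx => by
        by_cases h0 : x = 0
        · rw [h0]
        · have := hpos x h0 (mem_ball_zero_iff.1 hx).le
          rw [hzero]
          linarith) ((1 / 4 : ℝ) • e) (by rw [mem_ball_zero_iff, hxn]; norm_num)
    rw [hzero] at h
    linarith
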